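/- Let $\mathbb F$ be an algebraically closed field of characteristic different from $2$ and $3$. A Lie superalgebra over $\mathbb F$ is an $\mathbb F$-vector space $L=L_0\oplus L_1$ graded by $\mathbb Z/2$ with a bilinear bracket such that $[L_a,L_b]\subseteq L_{a+b}$, $[x,y]=-(-1)^{|x||y|}[y,x]$ and $(-1)^{|x||z|}[x,[y,z]]+(-1)^{|y||x|}[y,[z,x]]+(-1)^{|z||y|}[z,[x,y]]=0$ for all homogeneous $x,y,z$. It is nilpotent if $L^c=0$ for some $c\ge 1$, where $L^1=L$ and $L^{i+1}=[L^i,L]$, and it has dimension $(m|n)$ if $\dim L_0=m$ and $\dim L_1=n$. Its Schur multiplier is $\mathcal M(L)=(R\cap[F,F])/[R,F]$, where $0\to R\to F\to L\to 0$ is any presentation of $L$ with $F$ a free Lie superalgebra on a set of homogeneous generators. Let $L$ be a nilpotent Lie superalgebra over $\mathbb F$ of finite dimension $(m|n)$. Then, for every free presentation of $L$, $\mathcal M(L)$ is finite-dimensional, and $$\dim\mathcal M(L)=\tfrac12\big((m+n)^2+(n-m)\big)-1$$ if and only if $L\cong H(1)$, the Heisenberg Lie algebra with basis $x_1,x_2,z$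 and only nonzero brackets $[x_1,x_2]=-[x_2,x_1]=z$, regarded as a Lie superalgebra with zero odd part. In particular, if this equality holds, then $L_1=0$. -/

import Mathlib

noncomputable section

/-- A Lie superalgebra structure on the `K`-vector space `L`: a grading `L = L₀ ⊕ L₁` by parity
and a graded bracket. -/
structure LieSuperalgebra (K L : Type*) [Field K] [AddCommGroup L] [Module K L] where
  /-- The homogeneous component `L_a`, for `a` in `ℤ/2`. -/
  part : ZMod 2 → Submodule K L
  /-- The graded bracket. -/
  bracket : L →ₗ[K] L →ₗ[K] L
  isCompl : IsCompl (part 0) (part 1)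
  bracket_mem : ∀ {a b : ZMod 2} {x y : L}, x ∈ part a → y ∈ part b →
    bracket x y ∈ part (a + b)
  skew : ∀ {a b : ZMod 2} {x y : L}, x ∈ part a → y ∈ part b →
    bracket x y = -((-1 : K) ^ (a.val * b.val) • bracket y x)
  jacobi : ∀ {a b c : ZMod 2} {x y z : L}, x ∈ part a → y ∈ part b → z ∈ part c →
    (-1 : K) ^ (a.val * c.val) • bracket x (bracket y z) +
      (-1 : K) ^ (b.val * a.val) • bracket y (bracket z x) +
      (-1 : K) ^ (c.val * b.val) • bracket z (bracket x y) = 0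

namespace LieSuperalgebra

variable {K L M : Type*} [Field K] [AddCommGroup L] [Module K L] [AddCommGroup M] [Module K M]

/-- Homomorphisms of Lie superalgebras: even linear maps that preserve the bracket. -/
structure IsHom (A : LieSuperalgebra K L) (B : LieSuperalgebra K M) (f : L →ₗ[K] M) : Prop where
  map_part : ∀ (a : ZMod 2) (x : L), x ∈ A.part a → f x ∈ B.part a
  map_bracket : ∀ x y : L, f (A.bracket x y) = B.bracket (f x) (f y)

/-- Two Lie superalgebras are isomorphic. -/
def IsIsomorphic (A : LieSuperalgebra K L) (B : LieSuperalgebra K M) : Prop :=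
  ∃ e : L ≃ₗ[K] M, A.IsHom B (e : L →ₗ[K] M) ∧ B.IsHom A (e.symm : M →ₗ[K] L)

/-- `[U, V]`, the linear span of all brackets `[u, v]` with `u ∈ U` and `v ∈ V`. -/
def commutator (A : LieSuperalgebra K L) (U V : Submodule K L) : Submodule K L :=
  Submodule.span K {w | ∃ u ∈ U, ∃ v ∈ V, A.bracket u v = w}

/-- The lower central series, with `A.lowerSeries 0 = L` and
`A.lowerSeries (i + 1) = [A.lowerSeries i, L]`. -/
def lowerSeries (A : LieSuperalgebra K L) : ℕ → Submodule K L
  | 0 => ⊤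
  | i + 1 => A.commutator (A.lowerSeries i) ⊤

/-- Nilpotency: the lower central series reaches `0`. -/
def IsNilpotent (A : LieSuperalgebra K L) : Prop :=
  ∃ c : ℕ, A.lowerSeries c = ⊥

end LieSuperalgebra

/-! ### The free Lie superalgebra on a set of homogeneous generators

The generator `x : X` has parity `p x`. We take the free nonassociative algebra on `X`, whose basis
is the set `FreeMagma X` of nonassociative words, and divide by the two-sided ideal generated by
graded antisymmetry and the graded Jacobi identity. -/

namespace FreeLieSuperalgebra

variable (K : Type*) [Field K] {X : Type*} (p : X → ZMod 2)

/-- The parity of a word is the sum of the parities of its letters. -/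
def parity : FreeMagma X → ZMod 2
  | .of x => p x
  | .mul u v => parity u + parity v

/-- The underlying space of the free nonassociative algebra on `X`. -/
abbrev Words (X : Type*) : Type _ := FreeMagma X →₀ K

variable {K} in
/-- A word, seen as a basis vector of the free nonassociative algebra. -/
def word (u : FreeMagma X) : Words K X := Finsupp.single u 1

/-- The product of the free nonassociative algebra: the bilinear extension of the product of
words. -/
def mul : Words K X →ₗ[K] Words K X →ₗ[K] Words K X :=
  Finsupp.linearCombination K fun u => Finsupp.linearCombination K fun v => word (u * v)

/-- Elements that span the ideal of relations. -/
inductive Relation : Words K X → Prop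
  | skew (u v : FreeMagma X) :
      Relation (word (u * v) +
        (-1 : K) ^ ((parity p u).val * (parity p v).val) • word (v * u))
  | jacobi (u v w : FreeMagma X) :
      Relation ((-1 : K) ^ ((parity p u).val * (parity p w).val) • word (u * (v * w)) +
        (-1 : K) ^ ((parity p v).val * (parity p u).val) • word (v * (w * u)) +
        (-1 : K) ^ ((parity p w).val * (parity p v).val) • word (w * (u * v)))
  | mul_left (u : FreeMagma X) {r : Words K X} : Relation r → Relation (mul K (word u) r)
  | mul_right (u : FreeMagma X) {r : Words K X} : Relation r → Relation (mul K r (word u))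

/-- The ideal of relations. -/
def relations : Submodule K (Words K X) := Submodule.span K {r | Relation K p r}

/-- The underlying space of the free Lie superalgebra. -/
abbrev Carrier : Type _ := Words K X ⧸ relations K p

/-- The span of the words of parity `a`. -/
def wordPart (a : ZMod 2) : Submodule K (Words K X) :=
  Finsupp.supported K K {u | parity p u = a}

lemma parity_mul (u v : FreeMagma X) : parity p (u * v) = parity p u + parity p v := rfl

lemma mul_word (u v : FreeMagma X) : mul K (word u) (word v) = word (u * v) := by
  simp [mul, word]

lemma word_mem (u : FreeMagma X) : (word u : Words K X) ∈ wordPart K p (parity p u) :=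
  Finsupp.single_mem_supported K 1 rfl

lemma isCompl_wordPart : IsCompl (wordPart K p 0) (wordPart K p 1) := by
  constructor
  · refine Finsupp.disjoint_supported_supported (Set.disjoint_left.2 ?_)
    intro u hu hv
    exact absurd (hu.symm.trans hv) (by decide)
  · refine Finsupp.codisjoint_supported_supported (codisjoint_iff.2 (Set.eq_univ_of_forall ?_))
    intro u
    have h : ∀ a : ZMod 2, a = 0 ∨ a = 1 := by decide
    exact h (parity p u)

/-- To prove a property of elements of parity `a`, it suffices to treat words. -/
lemma wordPart_induction {a : ZMod 2} {P : Words K X → Prop} (zero : P 0)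
    (add : ∀ x y, P x → P y → P (x + y)) (smul : ∀ (c : K) x, P x → P (c • x))
    (hw : ∀ u, parity p u = a → P (word u)) {x : Words K X} (hx : x ∈ wordPart K p a) : P x := by
  rw [wordPart, Finsupp.supported_eq_span_single] at hx
  induction hx using Submodule.span_induction with
  | mem x h => obtain ⟨u, hu, rfl⟩ := h; exact hw u hu
  | zero => exact zero
  | add x y _ _ h h' => exact add x y h h'
  | smul c x _ h => exact smul c x h

lemma words_induction {P : Words K X → Prop} (zero : P 0)
    (add : ∀ x y, P x → P y → P (x + y)) (smul : ∀ (c : K) x, P x → P (c • x))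
    (hw : ∀ u, P (word u)) (x : Words K X) : P x := by
  induction x using Finsupp.induction_linear with
  | zero => exact zero
  | add x y h h' => exact add x y h h'
  | single u c =>
    have h := smul c _ (hw u)
    rwa [word, Finsupp.smul_single, smul_eq_mul, mul_one] at h

lemma mul_mem {a b : ZMod 2} {x y : Words K X} (hx : x ∈ wordPart K p a)
    (hy : y ∈ wordPart K p b) : mul K x y ∈ wordPart K p (a + b) := by
  refine wordPart_induction K p (P := fun x => mul K x y ∈ wordPart K p (a + b)) ?_ ?_ ?_ ?_ hx
  · simp
  · intro x x' h h'
    simpa using add_mem h h'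
  · intro c x h
    simpa using Submodule.smul_mem _ c h
  · rintro u rfl
    refine wordPart_induction K p (P := fun y => mul K (word u) y ∈ wordPart K p (_ + b))
      ?_ ?_ ?_ ?_ hy
    · simp
    · intro x x' h h'
      simpa using add_mem h h'
    · intro c x h
      simpa using Submodule.smul_mem _ c h
    · rintro v rfl
      rw [mul_word]
      exact word_mem K p (u * v)

lemma mul_relations_mem {r : Words K X} (x : Words K X) (hr : r ∈ relations K p) :
    mul K x r ∈ relations K p := by
  refine words_induction K (P := fun x => mul K x r ∈ relations K p) ?_ ?_ ?_ ?_ x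
  · simp
  · intro x x' h h'
    simpa using add_mem h h'
  · intro c x h
    simpa using Submodule.smul_mem _ c h
  · intro u
    have : relations K p ≤ (relations K p).comap (mul K (word u)) :=
      Submodule.span_le.2 fun r hr => Submodule.subset_span (Relation.mul_left u hr)
    exact this hr

lemma relations_mul_mem {r : Words K X} (x : Words K X) (hr : r ∈ relations K p) :
    mul K r x ∈ relations K p := by
  refine words_induction K (P := fun x => mul K r x ∈ relations K p) ?_ ?_ ?_ ?_ x
  · simp
  · intro x x' h h'
    simpa using add_mem h h'
  · intro c x h
    simpa using Submodule.smul_mem _ c h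
  · intro u
    induction hr using Submodule.span_induction with
    | mem r h => exact Submodule.subset_span (Relation.mul_right u h)
    | zero => simp
    | add r s _ _ h h' => simpa using add_mem h h'
    | smul c r _ h => simpa using Submodule.smul_mem _ c h

/-- The spanning relations are homogeneous. -/
lemma Relation.homogeneous {r : Words K X} (hr : Relation K p r) : ∃ a, r ∈ wordPart K p a := by
  induction hr with
  | skew u v =>
    refine ⟨parity p (u * v), add_mem (word_mem K p _) (Submodule.smul_mem _ _ ?_)⟩
    rw [parity_mul, add_comm, ← parity_mul]
    exact word_mem K p _
  | jacobi u v w =>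
    have h1 : parity p (v * (w * u)) = parity p (u * (v * w)) := by
      simp only [parity_mul]; abel
    have h2 : parity p (w * (u * v)) = parity p (u * (v * w)) := by
      simp only [parity_mul]; abel
    refine ⟨parity p (u * (v * w)), add_mem (add_mem ?_ ?_) ?_⟩
    · exact Submodule.smul_mem _ _ (word_mem K p _)
    · exact Submodule.smul_mem _ _ (h1 ▸ word_mem K p _)
    · exact Submodule.smul_mem _ _ (h2 ▸ word_mem K p _)
  | mul_left u _ ih =>
    obtain ⟨a, h⟩ := ih
    exact ⟨_, mul_mem K p (word_mem K p u) h⟩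
  | mul_right u _ ih =>
    obtain ⟨a, h⟩ := ih
    exact ⟨_, mul_mem K p h (word_mem K p u)⟩

lemma relations_le :
    relations K p ≤ (relations K p ⊓ wordPart K p 0) ⊔ (relations K p ⊓ wordPart K p 1) := by
  refine Submodule.span_le.2 fun r hr => ?_
  have hr' : r ∈ relations K p := Submodule.subset_span hr
  obtain ⟨a, ha⟩ := Relation.homogeneous K p hr
  have h : ∀ a : ZMod 2, a = 0 ∨ a = 1 := by decide
  rcases h a with rfl | rfl
  · exact Submodule.mem_sup_left ⟨hr', ha⟩
  · exact Submodule.mem_sup_right ⟨hr', ha⟩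

/-- The homogeneous components of the free Lie superalgebra. -/
def part (a : ZMod 2) : Submodule K (Carrier K p) :=
  (wordPart K p a).map (relations K p).mkQ

lemma isCompl_part : IsCompl (part K p 0) (part K p 1) := by
  constructor
  · rw [Submodule.disjoint_def]
    rintro _ ⟨x, hx, rfl⟩ ⟨y, hy, hxy⟩
    have hd : x - y ∈ relations K p := by
      rw [← (relations K p).ker_mkQ, LinearMap.mem_ker, map_sub, hxy, sub_self]
    obtain ⟨i, ⟨hi, hi0⟩, j, ⟨hj, hj1⟩, hij⟩ := Submodule.mem_sup.1 (relations_le K p hd)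
    have e : x - i = y + j := by
      have : x = i + j + y := by rw [hij]; abel
      rw [this]; abel
    have h0 : x - i = 0 := (Submodule.disjoint_def.1 (isCompl_wordPart K p).disjoint) _
      (sub_mem hx hi0) (e ▸ add_mem hy hj1)
    have : x = i := sub_eq_zero.1 h0
    rw [Submodule.mkQ_apply, Submodule.Quotient.mk_eq_zero, this]
    exact hi
  · rw [codisjoint_iff, part, part, ← Submodule.map_sup, (isCompl_wordPart K p).sup_eq_top,
      Submodule.map_top, Submodule.range_mkQ]

/-- The bracket of the free Lie superalgebra, induced by the product of words. -/
def bracket : Carrier K p →ₗ[K] Carrier K p →ₗ[K] Carrier K p :=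
  (relations K p).liftQ
    ((relations K p).liftQ ((mul K).compr₂ (relations K p).mkQ).flip (fun r hr => by
      refine LinearMap.ext fun x => ?_
      exact (Submodule.Quotient.mk_eq_zero _).2 (mul_relations_mem K p x hr))).flip
    (fun r hr => by
      refine LinearMap.ext fun q => ?_
      obtain ⟨x, rfl⟩ := (relations K p).mkQ_surjective q
      exact (Submodule.Quotient.mk_eq_zero _).2 (relations_mul_mem K p x hr))

lemma bracket_mk (x y : Words K X) :
    bracket K p ((relations K p).mkQ x) ((relations K p).mkQ y) =
      (relations K p).mkQ (mul K x y) := rfl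

/-- A linear map that vanishes on the classes of words of parity `a` vanishes on the component of
parity `a`. -/
lemma eq_zero_of_words {N : Type*} [AddCommGroup N] [Module K N] (f : Carrier K p →ₗ[K] N)
    {a : ZMod 2} (hf : ∀ u, parity p u = a → f ((relations K p).mkQ (word u)) = 0)
    {x : Carrier K p} (hx : x ∈ part K p a) : f x = 0 := by
  obtain ⟨x, hx, rfl⟩ := hx
  refine wordPart_induction K p (P := fun x => f ((relations K p).mkQ x) = 0) ?_ ?_ ?_ hf hx
  · rw [map_zero, map_zero]
  · intro x y h h'
    rw [map_add, map_add, h, h', add_zero]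
  · intro c x h
    rw [map_smul, map_smul, h, smul_zero]

lemma bracket_skew {a b : ZMod 2} {x y : Carrier K p} (hx : x ∈ part K p a)
    (hy : y ∈ part K p b) :
    bracket K p x y = -((-1 : K) ^ (a.val * b.val) • bracket K p y x) := by
  rw [eq_neg_iff_add_eq_zero]
  refine eq_zero_of_words K p
    ((bracket K p).flip y + (-1 : K) ^ (a.val * b.val) • bracket K p y) ?_ hx
  rintro u rfl
  refine eq_zero_of_words K p (bracket K p ((relations K p).mkQ (word u)) +
    (-1 : K) ^ ((parity p u).val * b.val) •
      (bracket K p).flip ((relations K p).mkQ (word u))) ?_ hy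
  rintro v rfl
  have h := (Submodule.Quotient.mk_eq_zero (relations K p)).2
    (Submodule.subset_span (Relation.skew (K := K) (p := p) u v))
  rw [← mul_word, ← mul_word] at h
  exact h

lemma bracket_jacobi {a b c : ZMod 2} {x y z : Carrier K p} (hx : x ∈ part K p a)
    (hy : y ∈ part K p b) (hz : z ∈ part K p c) :
    (-1 : K) ^ (a.val * c.val) • bracket K p x (bracket K p y z) +
      (-1 : K) ^ (b.val * a.val) • bracket K p y (bracket K p z x) +
      (-1 : K) ^ (c.val * b.val) • bracket K p z (bracket K p x y) = 0 := by
  refine eq_zero_of_words K p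
    ((-1 : K) ^ (a.val * c.val) • (bracket K p).flip (bracket K p y z) +
      (-1 : K) ^ (b.val * a.val) • (bracket K p y ∘ₗ bracket K p z) +
      (-1 : K) ^ (c.val * b.val) • (bracket K p z ∘ₗ (bracket K p).flip y)) ?_ hx
  rintro u rfl
  generalize hU : (relations K p).mkQ (word u) = U
  refine eq_zero_of_words K p
    ((-1 : K) ^ ((parity p u).val * c.val) • (bracket K p U ∘ₗ (bracket K p).flip z) +
      (-1 : K) ^ (b.val * (parity p u).val) • (bracket K p).flip (bracket K p z U) +
      (-1 : K) ^ (c.val * b.val) • (bracket K p z ∘ₗ bracket K p U)) ?_ hy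
  rintro v rfl
  generalize hV : (relations K p).mkQ (word v) = V
  refine eq_zero_of_words K p
    ((-1 : K) ^ ((parity p u).val * c.val) • (bracket K p U ∘ₗ bracket K p V) +
      (-1 : K) ^ ((parity p v).val * (parity p u).val) •
        (bracket K p V ∘ₗ (bracket K p).flip U) +
      (-1 : K) ^ (c.val * (parity p v).val) • (bracket K p).flip (bracket K p U V)) ?_ hz
  rintro w rfl
  have h := (Submodule.Quotient.mk_eq_zero (relations K p)).2
    (Submodule.subset_span (Relation.jacobi (K := K) (p := p) u v w))
  simp only [← mul_word] at h
  rw [← hU, ← hV]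
  exact h

end FreeLieSuperalgebra

/-- The free Lie superalgebra over `K` on the set `X` of homogeneous generators, `x : X` having
parity `p x`. -/
def freeLieSuperalgebra (K : Type*) [Field K] {X : Type*} (p : X → ZMod 2) :
    LieSuperalgebra K (FreeLieSuperalgebra.Carrier K p) where
  part := FreeLieSuperalgebra.part K p
  bracket := FreeLieSuperalgebra.bracket K p
  isCompl := FreeLieSuperalgebra.isCompl_part K p
  bracket_mem := by
    rintro a b _ _ ⟨x, hx, rfl⟩ ⟨y, hy, rfl⟩
    exact ⟨_, FreeLieSuperalgebra.mul_mem K p hx hy, rfl⟩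
  skew := FreeLieSuperalgebra.bracket_skew K p
  jacobi := FreeLieSuperalgebra.bracket_jacobi K p

namespace LieSuperalgebra

/-- A free presentation `0 → R → F → L → 0` of a Lie superalgebra `L`: a surjective homomorphism
`F → L` from a free Lie superalgebra `F`; the graded ideal `R` is its kernel. -/
structure FreePresentation {K L : Type*} [Field K] [AddCommGroup L] [Module K L]
    (A : LieSuperalgebra K L) (X : Type*) where
  /-- The parity of the free generators. -/
  parity : X → ZMod 2
  /-- The projection onto `L`. -/
  proj : FreeLieSuperalgebra.Carrier K parity →ₗ[K] L
  isHom : (freeLieSuperalgebra K parity).IsHom A proj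
  surjective : Function.Surjective proj

namespace FreePresentation

variable {K L : Type*} [Field K] [AddCommGroup L] [Module K L] {A : LieSuperalgebra K L}
  {X : Type*} (P : A.FreePresentation X)

/-- The free Lie superalgebra `F`. -/
abbrev free : LieSuperalgebra K (FreeLieSuperalgebra.Carrier K P.parity) :=
  freeLieSuperalgebra K P.parity

/-- The ideal of relations `R`. -/
def kernel : Submodule K (FreeLieSuperalgebra.Carrier K P.parity) := LinearMap.ker P.proj

/-- The Schur multiplier `(R ∩ [F, F]) / [R, F]` of `L`. -/
abbrev SchurMultiplier : Type _ :=
  ↥(P.kernel ⊓ P.free.commutator ⊤ ⊤) ⧸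
    (P.free.commutator P.kernel ⊤).submoduleOf (P.kernel ⊓ P.free.commutator ⊤ ⊤)

end FreePresentation

/-- The Heisenberg Lie algebra `H(1)`, with basis `x₁ = e₀`, `x₂ = e₁`, `z = e₂` and nonzero
bracket `[x₁, x₂] = z`, viewed as a Lie superalgebra with zero odd part. -/
def heisenberg (K : Type*) [Field K] : LieSuperalgebra K (Fin 3 → K) where
  part a := if a = 0 then ⊤ else ⊥
  bracket := LinearMap.mk₂ K (fun x y => ![0, 0, x 0 * y 1 - x 1 * y 0])
    (by intro x x' y; ext i; fin_cases i <;> simp; ring)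
    (by intro c x y; ext i; fin_cases i <;> simp; ring)
    (by intro x y y'; ext i; fin_cases i <;> simp; ring)
    (by intro c x y; ext i; fin_cases i <;> simp; ring)
  isCompl := by simpa using isCompl_top_bot
  bracket_mem := by
    intro a b x y hx hy
    have h : ∀ a : ZMod 2, a = 0 ∨ a = 1 := by decide
    rcases h a with rfl | rfl
    · rcases h b with rfl | rfl
      · simp
      · have : y = 0 := by simpa using hy
        simp [this]
    · have : x = 0 := by simpa using hx
      rw [this, map_zero, LinearMap.zero_apply]
      exact zero_mem _
  skew := by
    intro a b x y hx hy
    have h : ∀ a : ZMod 2, a = 0 ∨ a = 1 := by decide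
    rcases h a with rfl | rfl
    · ext i; fin_cases i <;> simp; ring
    · have : x = 0 := by simpa using hx
      subst this
      ext i; fin_cases i <;> simp
  jacobi := by
    intro a b c x y z _ _ _
    ext i; fin_cases i <;> simp

end LieSuperalgebra

end

/-! Let W be the graded exterior square of L, realized inside L ⊗ L as the range of `superWedge`. As
2 is invertible, W has one basis vector for each unordered pair of distinct basis vectors of L and
one for each odd basis vector, so dim W = ½((m+n)² + (n−m)). The ideal R becomes central in F/[R,F],
so the bracket there descends to a map φ on L ⊗ L (`coverBracket`), and φ(W) = [F,F]/[R,F].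
Projecting onto [L,L] has kernel 𝓜(L), hence dim 𝓜(L) + dim [L,L] = dim φ(W) ≤ dim W
(`finrank_schurMultiplier_add`).

Equality dim φ(W) = dim W holds exactly when the Jacobi expressions x ∧ [y,z] + ⋯ vanish in W. They
are killed by φ, so injectivity of φ on W forces them to be zero (`jacobiVanishes_of_finrank_eq`).
If they are zero, the assignment [f,g] ↦ f̄ ∧ ḡ is well defined on F and on F/[R,F], which recovers
the wedge from φ (`exists_comp_coverBracket_eq`).

If dim 𝓜(L) = dim W − 1, then dim [L,L] ≤ 1. An abelian L attains dim W itself, so dim [L,L] = 1 and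
the Jacobi expressions vanish in W. Let z = [x,y] span [L,L]; it is central by nilpotency. The
triple (x,y,x) shows that x and y are even (`eq_zero_of_jacobiVanishes`), and the triples (x,y,w)
show that every w lies in the span of x, y, z (`isIsomorphic_heisenberg`). Conversely, the Jacobi
expressions of H(1) vanish in W by a determinant identity. -/

noncomputable section

open scoped TensorProduct

namespace LieSuperalgebra

/-! ### The graded exterior square and its dimension -/

section Swap

variable {K L : Type*} [Field K] [AddCommGroup L] [Module K L] (A : LieSuperalgebra K L)

lemma homogeneous_induction {P : L → Prop} (hom : ∀ a, ∀ x ∈ A.part a, P x)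
    (add : ∀ x y, P x → P y → P (x + y)) (x : L) : P x := by
  have hx : x ∈ A.part 0 ⊔ A.part 1 := A.isCompl.sup_eq_top ▸ Submodule.mem_top
  obtain ⟨y, hy, z, hz, rfl⟩ := Submodule.mem_sup.1 hx
  exact add _ _ (hom _ _ hy) (hom _ _ hz)

/-- The projection onto the odd part along the even part. -/
def oddProj : L →ₗ[K] L := (A.part 1).projection (A.part 0) A.isCompl.symm

lemma oddProj_apply {a : ZMod 2} {x : L} (hx : x ∈ A.part a) :
    A.oddProj x = (a.val : K) • x := by
  have h : ∀ a : ZMod 2, a = 0 ∨ a = 1 := by decide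
  rcases h a with rfl | rfl
  · simpa [oddProj] using hx
  · simpa [oddProj, ZMod.val_one] using hx

/-- The graded flip `x ⊗ y ↦ (-1) ^ (|x| |y|) • y ⊗ x`. -/
def superSwap : L ⊗[K] L →ₗ[K] L ⊗[K] L :=
  (TensorProduct.comm K L L).toLinearMap ∘ₗ
    -- The sign is −1 only on odd ⊗ odd, where 1 − 2 = −1.
    (LinearMap.id - (2 : K) • TensorProduct.map A.oddProj A.oddProj)

lemma superSwap_tmul {a b : ZMod 2} {x y : L} (hx : x ∈ A.part a) (hy : y ∈ A.part b) :
    A.superSwap (x ⊗ₜ y) = (-1 : K) ^ (a.val * b.val) • (y ⊗ₜ[K] x) := by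
  have h : ∀ a : ZMod 2, a = 0 ∨ a = 1 := by decide
  simp only [superSwap, LinearMap.comp_apply, LinearMap.sub_apply, LinearMap.id_apply,
    LinearMap.smul_apply, TensorProduct.map_tmul, oddProj_apply A hx, oddProj_apply A hy, map_sub,
    map_smul, LinearEquiv.coe_coe, TensorProduct.comm_tmul]
  rcases h a with rfl | rfl <;> rcases h b with rfl | rfl <;> simp [ZMod.val_one, two_smul]

/-- The graded antisymmetrization `x ⊗ y ↦ x ⊗ y - (-1) ^ (|x| |y|) • y ⊗ x`. -/
def superWedge : L ⊗[K] L →ₗ[K] L ⊗[K] L := LinearMap.id - A.superSwap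

lemma superWedge_tmul {a b : ZMod 2} {x y : L} (hx : x ∈ A.part a) (hy : y ∈ A.part b) :
    A.superWedge (x ⊗ₜ y) = x ⊗ₜ y - (-1 : K) ^ (a.val * b.val) • (y ⊗ₜ[K] x) := by
  simp [superWedge, superSwap_tmul A hx hy]

lemma neg_one_pow_mul_self (k : ℕ) : (-1 : K) ^ k * (-1) ^ k = 1 := by
  rw [← mul_pow]; simp

lemma superWedge_tmul_swap {a b : ZMod 2} {x y : L} (hx : x ∈ A.part a) (hy : y ∈ A.part b) :
    A.superWedge (x ⊗ₜ y) = -((-1 : K) ^ (a.val * b.val) • A.superWedge (y ⊗ₜ x)) := by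
  rw [superWedge_tmul A hx hy, superWedge_tmul A hy hx, mul_comm b.val, smul_sub, smul_smul,
    neg_one_pow_mul_self]
  simp

/-- `u ∧ z` only vanishes when `u` is a multiple of `z`. -/
lemma mem_span_of_superWedge_eq_zero {a : ZMod 2} {u z : L} (hza : z ∈ A.part a) (hz : z ≠ 0)
    (h : A.superWedge (u ⊗ₜ z) = 0) : u ∈ K ∙ z := by
  by_contra hu
  -- Apply f ⊗ g to u ∧ z with f(z) = 0, f(u) ≠ 0 and g(z) = 1: the flipped terms all start with z
  -- and die, which leaves f(u).
  obtain ⟨f, hfu, hf⟩ := Submodule.exists_dual_map_eq_bot_of_notMem hu inferInstance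
  have hfz : f z = 0 :=
    LinearMap.le_ker_iff_map.2 hf (Submodule.mem_span_singleton_self z)
  obtain ⟨g, hg⟩ := Module.Projective.exists_dual_eq_one K hz
  have h' := congrArg (LinearMap.mul' K K ∘ₗ TensorProduct.map f g) h
  simp [superWedge, superSwap, oddProj_apply A hza, hfz, hg] at h'
  exact hfu h'

/-- The pairs indexing a basis of the graded exterior square. -/
def wedgePairs {ι : Type*} [Fintype ι] [LinearOrder ι] (q : ι → ZMod 2) : Finset (ι × ι) :=
  {p | p.1 < p.2 ∨ (p.1 = p.2 ∧ q p.1 = 1)}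

lemma finrank_range_superWedge_of_basis (h2 : (2 : K) ≠ 0) {ι : Type*} [Fintype ι] [LinearOrder ι]
    (b : Module.Basis ι K L) (q : ι → ZMod 2) (hb : ∀ i, b i ∈ A.part (q i)) :
    Module.finrank K (LinearMap.range A.superWedge) = (wedgePairs q).card := by
  set v : ι × ι → L ⊗[K] L := fun p => A.superWedge (b p.1 ⊗ₜ b p.2) with hv
  have h : ∀ a : ZMod 2, a = 0 ∨ a = 1 := by decide
  have hspan : LinearMap.range A.superWedge =
      Submodule.span K (Set.range fun p : wedgePairs q => v p) := by
    refine le_antisymm ?_ (Submodule.span_le.2 ?_)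
    · rw [LinearMap.range_eq_map, ← (b.tensorProduct b).span_eq, Submodule.map_span,
        Submodule.span_le]
      rintro _ ⟨_, ⟨⟨i, j⟩, rfl⟩, rfl⟩
      rw [Module.Basis.tensorProduct_apply]
      have key : ∀ p ∈ wedgePairs q,
          v p ∈ Submodule.span K (Set.range fun p : wedgePairs q => v p) :=
        fun p hp => Submodule.subset_span ⟨⟨p, hp⟩, rfl⟩
      rcases lt_trichotomy i j with hij | rfl | hij
      · exact key (i, j) (by simp [wedgePairs, hij])
      · rcases h (q i) with h0 | h1
        · rw [superWedge_tmul A (hb i) (hb i)]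
          simp [h0]
        · exact key (i, i) (by simp [wedgePairs, h1])
      · rw [superWedge_tmul_swap A (hb i) (hb j)]
        exact neg_mem (Submodule.smul_mem _ _ (key (j, i) (by simp [wedgePairs, hij])))
    · rintro _ ⟨p, rfl⟩
      exact ⟨_, rfl⟩
  have hli : LinearIndependent K fun p : wedgePairs q => v p := by
    rw [Fintype.linearIndependent_iff]
    intro g hg p
    obtain ⟨⟨i, j⟩, hp⟩ := p
    -- The coefficient at b i ⊗ b j sees only the wedge indexed by (i, j). It is 1 there if i < j,
    -- and 2 if i = j is odd, which is where 2 ≠ 0 enters.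
    have hc := congrArg (fun t => (b.tensorProduct b).repr t (i, j)) hg
    simp only [map_sum, map_smul, Finsupp.coe_finsetSum, Finset.sum_apply, Finsupp.smul_apply,
      map_zero, Finsupp.zero_apply] at hc
    rw [Finset.sum_eq_single ⟨(i, j), hp⟩] at hc
    · simp only [wedgePairs, Finset.mem_filter, Finset.mem_univ, true_and] at hp
      rw [hv] at hc
      simp only [superWedge_tmul A (hb i) (hb j), map_sub, map_smul, Finsupp.sub_apply,
        Finsupp.smul_apply, Module.Basis.tensorProduct_repr_tmul_apply, Module.Basis.repr_self,
        Finsupp.single_eq_same] at hc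
      rcases hp with hij | ⟨rfl, hi⟩
      · simpa [Finsupp.single_eq_of_ne hij.ne, Finsupp.single_eq_of_ne hij.ne'] using hc
      · rw [hi] at hc
        simp only [ZMod.val_one, Finsupp.single_eq_same, smul_eq_mul] at hc
        have h3 : g ⟨(i, i), by simpa [wedgePairs] using hi⟩ * 2 = 0 := by
          rw [← hc]; ring
        exact (mul_eq_zero.1 h3).resolve_right h2
    · rintro ⟨⟨k, l⟩, hkl⟩ _ hne
      simp only [wedgePairs, Finset.mem_filter, Finset.mem_univ, true_and] at hp hkl
      have hne' : ¬ (k = i ∧ l = j) := by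
        rintro ⟨rfl, rfl⟩
        exact hne rfl
      have hne'' : ¬ (l = i ∧ k = j) := by
        rintro ⟨rfl, rfl⟩
        rcases hp with hp | ⟨hp, -⟩ <;> rcases hkl with hkl | ⟨hkl, -⟩
        · exact lt_asymm hp hkl
        · exact hp.ne' hkl
        · exact hkl.ne' hp
        · exact hne' ⟨hp.symm, hp⟩
      rw [hv]
      simp only [superWedge_tmul A (hb k) (hb l), map_sub, map_smul, Finsupp.sub_apply,
        Finsupp.smul_apply, Module.Basis.tensorProduct_repr_tmul_apply, Module.Basis.repr_self,
        Finsupp.single_apply, smul_eq_mul]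
      split_ifs <;> simp_all
    · simp
  rw [hspan, finrank_span_eq_card hli, Fintype.card_coe]

/-- The increasing pairs are half of the off-diagonal ones, and the odd diagonal is added. The
additive form avoids truncated subtraction. -/
lemma two_mul_card_wedgePairs {ι : Type*} [Fintype ι] [LinearOrder ι] (q : ι → ZMod 2) :
    2 * (wedgePairs q).card + Fintype.card ι =
      Fintype.card ι ^ 2 + 2 * (Finset.univ.filter fun i => q i = 1).card := by
  have h1 : wedgePairs q = (Finset.univ.filter fun p : ι × ι => p.1 < p.2) ∪
      (Finset.univ.filter fun i => q i = 1).image (fun i => (i, i)) := by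
    ext ⟨i, j⟩
    simp only [wedgePairs, Finset.mem_filter, Finset.mem_univ, true_and, Finset.mem_union,
      Finset.mem_image, Prod.mk.injEq]
    grind
  have h2 : (Finset.univ.filter fun p : ι × ι => p.1 < p.2).card =
      (Finset.univ.filter fun p : ι × ι => p.2 < p.1).card :=
    Finset.card_equiv (Equiv.prodComm ι ι) (by simp)
  have h3 : (Finset.univ : Finset ι).offDiag = (Finset.univ.filter fun p : ι × ι => p.1 < p.2) ∪
      (Finset.univ.filter fun p : ι × ι => p.2 < p.1) := by
    ext ⟨i, j⟩
    simp [lt_or_lt_iff_ne]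
  have h4 := congrArg Finset.card h3
  rw [Finset.offDiag_card, Finset.card_union_of_disjoint, ← h2] at h4
  · rw [h1, Finset.card_union_of_disjoint, Finset.card_image_of_injective]
    · have : Fintype.card ι ≤ Fintype.card ι * Fintype.card ι := Nat.le_mul_self _
      simp only [Finset.card_univ] at h4
      rw [pow_two]
      omega
    · intro i j hij
      exact (Prod.mk.inj hij).1
    · rw [Finset.disjoint_left]
      rintro ⟨i, j⟩ hi hj
      simp at hi hj
      grind
  · rw [Finset.disjoint_left]
    rintro ⟨i, j⟩ hi hj
    simp at hi hj
    exact lt_asymm hi hj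

lemma finrank_range_superWedge (h2 : (2 : K) ≠ 0) [FiniteDimensional K L] :
    (Module.finrank K (LinearMap.range A.superWedge) : ℚ) =
      1 / 2 * (((Module.finrank K (A.part 0) : ℚ) + Module.finrank K (A.part 1)) ^ 2 +
        ((Module.finrank K (A.part 1) : ℚ) - Module.finrank K (A.part 0))) := by
  set m := Module.finrank K (A.part 0) with hm
  set n := Module.finrank K (A.part 1) with hn
  let b : Module.Basis (Fin m ⊕ Fin n) K L :=
    ((Module.finBasis K (A.part 0)).prod (Module.finBasis K (A.part 1))).map
      (Submodule.prodEquivOfIsCompl _ _ A.isCompl)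
  let q : Fin m ⊕ Fin n → ZMod 2 := Sum.elim (fun _ => 0) (fun _ => 1)
  -- Any linear order would do: it only selects one ordering of each pair of distinct basis vectors.
  let _ : LinearOrder (Fin m ⊕ Fin n) := LinearOrder.lift' finSumFinEquiv finSumFinEquiv.injective
  have hb : ∀ i, b i ∈ A.part (q i) := by
    rintro (i | i) <;> simp [b, q]
  have h := two_mul_card_wedgePairs q
  have hq : (Finset.univ.filter fun i => q i = 1).card = n := by
    have : (Finset.univ.filter fun i => q i = 1) = Finset.univ.map Function.Embedding.inr := by
      ext (i | i) <;> simp [q]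
    rw [this, Finset.card_map, Finset.card_univ, Fintype.card_fin]
  rw [← finrank_range_superWedge_of_basis A h2 b q hb, hq, Fintype.card_sum, Fintype.card_fin,
    Fintype.card_fin] at h
  have h' : (2 * (Module.finrank K (LinearMap.range A.superWedge)) + (m + n) : ℚ) =
    (m + n) ^ 2 + 2 * n := by exact_mod_cast h
  linarith

end Swap

/-! ### Jacobi expressions in the graded exterior square -/

section Cyc

variable {K L : Type*} [Field K] [AddCommGroup L] [Module K L] (A : LieSuperalgebra K L)

/-- The left side of the graded Jacobi identity for `x`, `y`, `z` of parities `a`, `b`, `c`, with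
the outer brackets replaced by tensors. -/
def jacobiTensor (a b c : ZMod 2) (x y z : L) : L ⊗[K] L :=
  (-1 : K) ^ (a.val * c.val) • x ⊗ₜ A.bracket y z +
    (-1 : K) ^ (b.val * a.val) • y ⊗ₜ A.bracket z x +
    (-1 : K) ^ (c.val * b.val) • z ⊗ₜ A.bracket x y

/-- The graded Jacobi identity holds in the graded exterior square. -/
def JacobiVanishes : Prop :=
  ∀ (a b c : ZMod 2) (x y z : L), x ∈ A.part a → y ∈ A.part b → z ∈ A.part c →
    A.superWedge (A.jacobiTensor a b c x y z) = 0

end Cyc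

/-! ### The bracket of F/[R,F] and the Schur multiplier -/

namespace FreePresentation

variable {K L : Type*} [Field K] [AddCommGroup L] [Module K L] {A : LieSuperalgebra K L}
  {X : Type*} (P : A.FreePresentation X)

/-- The quotient map `F → F / [R, F]`. -/
abbrev toCover : FreeLieSuperalgebra.Carrier K P.parity →ₗ[K]
    FreeLieSuperalgebra.Carrier K P.parity ⧸ P.free.commutator P.kernel ⊤ :=
  (P.free.commutator P.kernel ⊤).mkQ

lemma toCover_bracket_left {r : FreeLieSuperalgebra.Carrier K P.parity} (hr : P.proj r = 0)
    (f : FreeLieSuperalgebra.Carrier K P.parity) : P.toCover (P.free.bracket r f) = 0 :=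
  (Submodule.Quotient.mk_eq_zero _).2 (Submodule.subset_span ⟨r, hr, f, trivial, rfl⟩)

/-- Homogeneous elements have homogeneous lifts, and the components of an element of the kernel
lie in the kernel. -/
lemma exists_homogeneous (f : FreeLieSuperalgebra.Carrier K P.parity) :
    ∃ f₀ ∈ P.free.part 0, ∃ f₁ ∈ P.free.part 1, f = f₀ + f₁ ∧
      (P.proj f ∈ A.part 0 → P.proj f₁ = 0) ∧ (P.proj f ∈ A.part 1 → P.proj f₀ = 0) := by
  have hx : f ∈ P.free.part 0 ⊔ P.free.part 1 :=
    P.free.isCompl.sup_eq_top ▸ Submodule.mem_top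
  obtain ⟨f₀, h₀, f₁, h₁, rfl⟩ := Submodule.mem_sup.1 hx
  have h₀' := P.isHom.map_part _ _ h₀
  have h₁' := P.isHom.map_part _ _ h₁
  have hd := Submodule.disjoint_def.1 A.isCompl.disjoint
  refine ⟨f₀, h₀, f₁, h₁, rfl, fun h => hd _ ?_ h₁', fun h => hd _ h₀' ?_⟩
  · simpa using sub_mem h h₀'
  · simpa using sub_mem h h₁'

lemma exists_lift {a : ZMod 2} {x : L} (hx : x ∈ A.part a) :
    ∃ f ∈ P.free.part a, P.proj f = x := by
  obtain ⟨f, rfl⟩ := P.surjective x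
  obtain ⟨f₀, h₀, f₁, h₁, rfl, h, h'⟩ := P.exists_homogeneous f
  have key : ∀ a : ZMod 2, a = 0 ∨ a = 1 := by decide
  rcases key a with rfl | rfl
  · exact ⟨f₀, h₀, by simp [h hx]⟩
  · exact ⟨f₁, h₁, by simp [h' hx]⟩

/-- The commutator [R,F] has R on the left. Since R is graded, the homogeneous components of r stay
in R, and graded skew-symmetry moves each of them to the left. -/
lemma toCover_bracket_right {r : FreeLieSuperalgebra.Carrier K P.parity} (hr : P.proj r = 0)
    (f : FreeLieSuperalgebra.Carrier K P.parity) : P.toCover (P.free.bracket f r) = 0 := by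
  obtain ⟨r₀, h₀, r₁, h₁, rfl, h, h'⟩ := P.exists_homogeneous r
  have hr₁ := h (hr ▸ zero_mem _)
  have hr₀ := h' (hr ▸ zero_mem _)
  refine P.free.homogeneous_induction
    (P := fun f => P.toCover (P.free.bracket f (r₀ + r₁)) = 0) ?_ ?_ f
  · intro a x hx
    rw [map_add, P.free.skew hx h₀, P.free.skew hx h₁, map_add, map_neg, map_neg, map_smul,
      map_smul, P.toCover_bracket_left hr₀, P.toCover_bracket_left hr₁]
    simp
  · intro x y hx hy
    rw [map_add P.free.bracket, LinearMap.add_apply, map_add P.toCover, hx, hy, add_zero]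

/-- Changing f or g by an element of R does not change [f,g] modulo [R,F]. A merely linear section
of the projection therefore suffices to define the map. -/
lemma exists_coverBracket : ∃ φ : L ⊗[K] L →ₗ[K]
    FreeLieSuperalgebra.Carrier K P.parity ⧸ P.free.commutator P.kernel ⊤,
    ∀ f g, φ (P.proj f ⊗ₜ P.proj g) = P.toCover (P.free.bracket f g) := by
  obtain ⟨s, hs⟩ := P.proj.exists_rightInverse_of_surjective (LinearMap.range_eq_top.2 P.surjective)
  have hs' : ∀ x, P.proj (s x) = x := fun x => LinearMap.congr_fun hs x
  refine ⟨TensorProduct.lift ((P.free.bracket.compr₂ P.toCover).compl₁₂ s s), fun f g => ?_⟩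
  have h1 : P.toCover (P.free.bracket (s (P.proj f) - f) (s (P.proj g))) = 0 :=
    P.toCover_bracket_left (by simp [hs']) _
  have h2 : P.toCover (P.free.bracket f (s (P.proj g) - g)) = 0 :=
    P.toCover_bracket_right (by simp [hs']) _
  rw [map_sub, LinearMap.sub_apply, map_sub, sub_eq_zero] at h1
  rw [map_sub, map_sub, sub_eq_zero] at h2
  rw [← h2, ← h1]
  rfl

/-- The bracket of `F / [R, F]`, as a map on `L ⊗ L`. -/
def coverBracket : L ⊗[K] L →ₗ[K]
    FreeLieSuperalgebra.Carrier K P.parity ⧸ P.free.commutator P.kernel ⊤ :=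
  P.exists_coverBracket.choose

lemma coverBracket_tmul (f g : FreeLieSuperalgebra.Carrier K P.parity) :
    P.coverBracket (P.proj f ⊗ₜ P.proj g) = P.toCover (P.free.bracket f g) :=
  P.exists_coverBracket.choose_spec f g

lemma range_coverBracket :
    LinearMap.range P.coverBracket = (P.free.commutator ⊤ ⊤).map P.toCover := by
  apply le_antisymm
  · rw [LinearMap.range_eq_map, ← TensorProduct.span_tmul_eq_top, Submodule.map_span,
      Submodule.span_le]
    rintro _ ⟨_, ⟨x, y, rfl⟩, rfl⟩
    obtain ⟨f, rfl⟩ := P.surjective x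
    obtain ⟨g, rfl⟩ := P.surjective y
    rw [coverBracket_tmul]
    exact ⟨_, Submodule.subset_span ⟨f, trivial, g, trivial, rfl⟩, rfl⟩
  · refine Submodule.map_le_iff_le_comap.2 (Submodule.span_le.2 ?_)
    rintro _ ⟨f, -, g, -, rfl⟩
    exact ⟨_, P.coverBracket_tmul f g⟩

lemma coverBracket_superSwap (t : L ⊗[K] L) :
    P.coverBracket (A.superSwap t) = -P.coverBracket t := by
  induction t using TensorProduct.induction_on with
  | zero => simp
  | add s t hs ht => rw [map_add, map_add, map_add, hs, ht, neg_add]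
  | tmul x y =>
    refine A.homogeneous_induction
      (P := fun x => P.coverBracket (A.superSwap (x ⊗ₜ y)) = -P.coverBracket (x ⊗ₜ y)) ?_ ?_ x
    · intro a x hx
      refine A.homogeneous_induction
        (P := fun y => P.coverBracket (A.superSwap (x ⊗ₜ y)) = -P.coverBracket (x ⊗ₜ y)) ?_ ?_ y
      · intro b y hy
        obtain ⟨f, hf, rfl⟩ := P.exists_lift hx
        obtain ⟨g, hg, rfl⟩ := P.exists_lift hy
        rw [superSwap_tmul A hx hy, map_smul, coverBracket_tmul, coverBracket_tmul,
          P.free.skew hf hg, map_neg, neg_neg, map_smul]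
      · intro y y' h h'
        rw [TensorProduct.tmul_add, map_add, map_add, map_add, h, h', neg_add]
    · intro x x' h h'
      rw [TensorProduct.add_tmul, map_add, map_add, map_add, h, h', neg_add]

lemma coverBracket_superWedge (t : L ⊗[K] L) :
    P.coverBracket (A.superWedge t) = (2 : K) • P.coverBracket t := by
  simp [superWedge, coverBracket_superSwap, two_smul]

/-- This is the Jacobi identity of F modulo [R,F], since the inner bracket in L lifts to the bracket
of the lifts. -/
lemma coverBracket_jacobiTensor {a b c : ZMod 2} {x y z : L} (hx : x ∈ A.part a)
    (hy : y ∈ A.part b) (hz : z ∈ A.part c) :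
    P.coverBracket (A.jacobiTensor a b c x y z) = 0 := by
  obtain ⟨f, hf, rfl⟩ := P.exists_lift hx
  obtain ⟨g, hg, rfl⟩ := P.exists_lift hy
  obtain ⟨h, hh, rfl⟩ := P.exists_lift hz
  have hj := congrArg P.toCover (P.free.jacobi hf hg hh)
  simpa only [jacobiTensor, ← P.isHom.map_bracket, map_add, map_smul, coverBracket_tmul,
    map_zero] using hj

/-- On a wedge the map is twice its value on the tensor, so dividing by 2 shows that restricting to
the exterior square loses nothing. -/
lemma range_coverBracket_eq_map (h2 : (2 : K) ≠ 0) :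
    LinearMap.range P.coverBracket = (LinearMap.range A.superWedge).map P.coverBracket := by
  apply le_antisymm
  · rintro _ ⟨t, rfl⟩
    refine ⟨A.superWedge ((2 : K)⁻¹ • t), ⟨_, rfl⟩, ?_⟩
    rw [coverBracket_superWedge, map_smul, smul_inv_smul₀ h2]
  · rintro _ ⟨t, -, rfl⟩
    exact ⟨t, rfl⟩

/-! ### The dimension bound and its extremal case -/

section FiniteDimensional

variable [FiniteDimensional K L]

lemma finrank_range_coverBracket_le (h2 : (2 : K) ≠ 0) :
    Module.finrank K (LinearMap.range P.coverBracket) ≤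
      Module.finrank K (LinearMap.range A.superWedge) := by
  rw [P.range_coverBracket_eq_map h2]
  exact Submodule.finrank_map_le _ _

/-- By rank-nullity the bracket map is injective on the exterior square, and it kills the wedge of
every Jacobi expression. -/
lemma jacobiVanishes_of_finrank_eq (h2 : (2 : K) ≠ 0)
    (h : Module.finrank K (LinearMap.range P.coverBracket) =
      Module.finrank K (LinearMap.range A.superWedge)) : A.JacobiVanishes := by
  intro a b c x y z hx hy hz
  set f := P.coverBracket.domRestrict (LinearMap.range A.superWedge) with hf
  have hr : LinearMap.range f = LinearMap.range P.coverBracket := by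
    rw [P.range_coverBracket_eq_map h2, hf, LinearMap.range_domRestrict]
  have hk := f.finrank_range_add_finrank_ker
  rw [hr, h] at hk
  have hk' : LinearMap.ker f = ⊥ := Submodule.finrank_eq_zero.1 (by omega)
  have h0 : f ⟨_, A.jacobiTensor a b c x y z, rfl⟩ = 0 := by
    rw [hf, LinearMap.domRestrict_apply, coverBracket_superWedge,
      P.coverBracket_jacobiTensor hx hy hz, smul_zero]
  exact congrArg Subtype.val (LinearMap.ker_eq_bot'.1 hk' _ h0)

end FiniteDimensional

/-- The linear map on nonassociative words that sends `u * v` to the wedge of the images of `u`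
and `v` in `L`, and generators to `0`. -/
def wordWedge : FreeLieSuperalgebra.Words K X →ₗ[K] L ⊗[K] L :=
  Finsupp.linearCombination K fun w : FreeMagma X => match w with
    -- The value on generators is immaterial: relations and brackets involve only words of length at
    -- least two.
    | .of _ => 0
    | .mul u v => A.superWedge
        (P.proj (Submodule.mkQ _ (FreeLieSuperalgebra.word u)) ⊗ₜ
          P.proj (Submodule.mkQ _ (FreeLieSuperalgebra.word v)))

lemma wordWedge_mul (x y : FreeLieSuperalgebra.Words K X) :
    P.wordWedge (FreeLieSuperalgebra.mul K x y) =
      A.superWedge (P.proj (Submodule.mkQ _ x) ⊗ₜ P.proj (Submodule.mkQ _ y)) := by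
  refine FreeLieSuperalgebra.words_induction K (P := fun x => P.wordWedge
    (FreeLieSuperalgebra.mul K x y) =
      A.superWedge (P.proj (Submodule.mkQ _ x) ⊗ₜ P.proj (Submodule.mkQ _ y))) ?_ ?_ ?_ ?_ x
  · simp
  · intro x x' h h'
    simp only [map_add, LinearMap.add_apply, TensorProduct.add_tmul, h, h']
  · intro c x h
    simp only [map_smul, LinearMap.smul_apply, ← TensorProduct.smul_tmul', h]
  · intro u
    refine FreeLieSuperalgebra.words_induction K (P := fun y => P.wordWedge
      (FreeLieSuperalgebra.mul K (FreeLieSuperalgebra.word u) y) =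
        A.superWedge (P.proj (Submodule.mkQ _ (FreeLieSuperalgebra.word u)) ⊗ₜ
          P.proj (Submodule.mkQ _ y))) ?_ ?_ ?_ ?_ y
    · simp
    · intro x x' h h'
      simp only [map_add, TensorProduct.tmul_add, h, h']
    · intro c x h
      simp only [map_smul, TensorProduct.tmul_smul, h]
    · intro v
      rw [FreeLieSuperalgebra.mul_word, FreeLieSuperalgebra.word, wordWedge,
        Finsupp.linearCombination_single, one_smul]

lemma proj_word_mem (u : FreeMagma X) :
    P.proj (Submodule.mkQ _ (FreeLieSuperalgebra.word u)) ∈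
      A.part (FreeLieSuperalgebra.parity P.parity u) :=
  P.isHom.map_part _ _ ⟨_, FreeLieSuperalgebra.word_mem K P.parity u, rfl⟩

lemma proj_mkQ_mul (x y : FreeLieSuperalgebra.Words K X) :
    P.proj (Submodule.mkQ _ (FreeLieSuperalgebra.mul K x y)) =
      A.bracket (P.proj (Submodule.mkQ _ x)) (P.proj (Submodule.mkQ _ y)) :=
  P.isHom.map_bracket (Submodule.mkQ _ x) (Submodule.mkQ _ y)

/-- Only the skew and Jacobi relations carry content. A relation multiplied by a word has a factor
that is already zero in L, so no induction is needed. -/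
lemma wordWedge_relation (hJ : A.JacobiVanishes) {r : FreeLieSuperalgebra.Words K X}
    (hr : FreeLieSuperalgebra.Relation K P.parity r) : P.wordWedge r = 0 := by
  have hzero : ∀ {r}, FreeLieSuperalgebra.Relation K P.parity r →
      Submodule.mkQ (FreeLieSuperalgebra.relations K P.parity) r = 0 := fun h =>
    (Submodule.Quotient.mk_eq_zero _).2 (Submodule.subset_span h)
  cases hr with
  | skew u v =>
    simp only [← FreeLieSuperalgebra.mul_word, map_add, map_smul, wordWedge_mul]
    rw [superWedge_tmul_swap A (P.proj_word_mem u) (P.proj_word_mem v), neg_add_cancel]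
  | jacobi u v w =>
    have h := hJ _ _ _ _ _ _ (P.proj_word_mem u) (P.proj_word_mem v) (P.proj_word_mem w)
    simp only [← FreeLieSuperalgebra.mul_word, map_add, map_smul, wordWedge_mul, proj_mkQ_mul]
    simpa only [jacobiTensor, map_add, map_smul] using h
  | mul_left u h => rw [wordWedge_mul, hzero h]; simp
  | mul_right u h => rw [wordWedge_mul, hzero h]; simp

/-- The map [f,g] ↦ f̄ ∧ ḡ descends from words to F because it respects the relations, and then to
F/[R,F] because elements of R project to 0. -/
lemma exists_comp_coverBracket_eq (hJ : A.JacobiVanishes) :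
    ∃ ψ : (FreeLieSuperalgebra.Carrier K P.parity ⧸ P.free.commutator P.kernel ⊤) →ₗ[K] L ⊗[K] L,
      ψ ∘ₗ P.coverBracket = A.superWedge := by
  set t : FreeLieSuperalgebra.Carrier K P.parity →ₗ[K] L ⊗[K] L :=
    (FreeLieSuperalgebra.relations K P.parity).liftQ P.wordWedge
      (Submodule.span_le.2 fun r hr => P.wordWedge_relation hJ hr)
  have ht : ∀ f g, t (P.free.bracket f g) = A.superWedge (P.proj f ⊗ₜ P.proj g) := by
    intro f g
    obtain ⟨x, rfl⟩ := Submodule.mkQ_surjective _ f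
    obtain ⟨y, rfl⟩ := Submodule.mkQ_surjective _ g
    exact P.wordWedge_mul x y
  refine ⟨Submodule.liftQ _ t (Submodule.span_le.2 ?_), TensorProduct.ext' fun x y => ?_⟩
  · rintro _ ⟨r, hr, f, -, rfl⟩
    change t _ = 0
    rw [ht, show P.proj r = 0 from hr]
    simp
  · obtain ⟨f, rfl⟩ := P.surjective x
    obtain ⟨g, rfl⟩ := P.surjective y
    rw [LinearMap.comp_apply, coverBracket_tmul, ← ht]
    rfl

lemma finrank_range_coverBracket_eq [FiniteDimensional K L] (h2 : (2 : K) ≠ 0)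
    (hJ : A.JacobiVanishes) :
    Module.finrank K (LinearMap.range P.coverBracket) =
      Module.finrank K (LinearMap.range A.superWedge) := by
  refine le_antisymm (P.finrank_range_coverBracket_le h2) ?_
  obtain ⟨ψ, hψ⟩ := P.exists_comp_coverBracket_eq hJ
  rw [← hψ, LinearMap.range_comp]
  exact Submodule.finrank_map_le _ _

/-- The Schur multiplier, embedded in `F / [R, F]`. -/
def multiplierEmbedding : P.SchurMultiplier →ₗ[K]
    FreeLieSuperalgebra.Carrier K P.parity ⧸ P.free.commutator P.kernel ⊤ :=
  Submodule.liftQ _ (P.toCover ∘ₗ Submodule.subtype _) fun _ hx =>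
    LinearMap.mem_ker.2 ((Submodule.Quotient.mk_eq_zero _).2 hx)

lemma multiplierEmbedding_injective : Function.Injective P.multiplierEmbedding := by
  rw [← LinearMap.ker_eq_bot]
  refine Submodule.ker_liftQ_eq_bot _ _ _ fun x hx => ?_
  exact (Submodule.Quotient.mk_eq_zero (P.free.commutator P.kernel ⊤)).1 hx

lemma range_multiplierEmbedding : LinearMap.range P.multiplierEmbedding =
    (P.kernel ⊓ P.free.commutator ⊤ ⊤).map P.toCover := by
  rw [multiplierEmbedding, Submodule.range_liftQ, LinearMap.range_comp, Submodule.range_subtype]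

lemma range_multiplierEmbedding_le :
    LinearMap.range P.multiplierEmbedding ≤ LinearMap.range P.coverBracket := by
  rw [range_multiplierEmbedding, range_coverBracket]
  exact Submodule.map_mono inf_le_right

lemma finite_schurMultiplier [FiniteDimensional K L] : Module.Finite K P.SchurMultiplier := by
  have := Submodule.finiteDimensional_of_le P.range_multiplierEmbedding_le
  exact Module.Finite.equiv (LinearEquiv.ofInjective _ P.multiplierEmbedding_injective).symm

lemma map_proj_commutator :
    (P.free.commutator ⊤ ⊤).map P.proj = A.commutator ⊤ ⊤ := by
  rw [commutator, commutator, Submodule.map_span]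
  congr 1
  ext w
  constructor
  · rintro ⟨_, ⟨f, -, g, -, rfl⟩, rfl⟩
    exact ⟨_, trivial, _, trivial, (P.isHom.map_bracket f g).symm⟩
  · rintro ⟨x, -, y, -, rfl⟩
    obtain ⟨f, rfl⟩ := P.surjective x
    obtain ⟨g, rfl⟩ := P.surjective y
    exact ⟨_, ⟨f, trivial, g, trivial, rfl⟩, P.isHom.map_bracket f g⟩

/-- Rank-nullity for the projection of [F,F]/[R,F] onto [L,L], whose kernel is (R ∩ [F,F])/[R,F]. -/
lemma finrank_schurMultiplier_add [FiniteDimensional K L] :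
    Module.finrank K P.SchurMultiplier + Module.finrank K (A.commutator ⊤ ⊤) =
      Module.finrank K (LinearMap.range P.coverBracket) := by
  have hC : P.free.commutator P.kernel ⊤ ≤ LinearMap.ker P.proj := by
    refine Submodule.span_le.2 ?_
    rintro _ ⟨r, hr, f, -, rfl⟩
    change P.proj _ = 0
    rw [P.isHom.map_bracket, show P.proj r = 0 from hr]
    simp
  set π := (P.free.commutator P.kernel ⊤).liftQ P.proj hC
  set g := π.domRestrict (LinearMap.range P.coverBracket) with hg
  have hgr : LinearMap.range g = A.commutator ⊤ ⊤ := by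
    rw [hg, LinearMap.range_domRestrict, range_coverBracket, ← Submodule.map_comp,
      Submodule.liftQ_mkQ, map_proj_commutator]
  have hgk : (LinearMap.ker g).map (Submodule.subtype _) =
      LinearMap.range P.multiplierEmbedding := by
    rw [range_multiplierEmbedding]
    ext w
    constructor
    · rintro ⟨⟨w, hw⟩, hk, rfl⟩
      rw [range_coverBracket] at hw
      obtain ⟨f, hf, rfl⟩ := hw
      exact ⟨f, ⟨hk, hf⟩, rfl⟩
    · rintro ⟨f, ⟨hk, hf⟩, rfl⟩
      have hw : P.toCover f ∈ LinearMap.range P.coverBracket :=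
        P.range_coverBracket ▸ Submodule.mem_map_of_mem hf
      exact ⟨⟨_, hw⟩, LinearMap.mem_ker.2 (show P.proj f = 0 from hk), rfl⟩
  have h := g.finrank_range_add_finrank_ker
  rw [hgr, ← Submodule.finrank_map_subtype_eq, hgk,
    LinearMap.finrank_range_of_inj P.multiplierEmbedding_injective] at h
  rw [← h, add_comm]

end FreePresentation

/-! ### Superalgebras with one-dimensional derived algebra -/

section RankOne

variable {K L : Type*} [Field K] [AddCommGroup L] [Module K L] {A : LieSuperalgebra K L}

lemma bracket_mem_commutator (x y : L) : A.bracket x y ∈ A.commutator ⊤ ⊤ :=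
  Submodule.subset_span ⟨x, trivial, y, trivial, rfl⟩

lemma exists_homogeneous_bracket_ne_zero (h : A.commutator ⊤ ⊤ ≠ ⊥) :
    ∃ (a b : ZMod 2) (x y : L), x ∈ A.part a ∧ y ∈ A.part b ∧ A.bracket x y ≠ 0 := by
  by_contra! hxy
  refine h (le_bot_iff.1 (Submodule.span_le.2 ?_))
  rintro _ ⟨x, -, y, -, rfl⟩
  change A.bracket x y = 0
  refine A.homogeneous_induction (P := fun x => A.bracket x y = 0) ?_ ?_ x
  · intro a x hx
    refine A.homogeneous_induction (P := fun y => A.bracket x y = 0) ?_ ?_ y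
    · exact fun b y hy => hxy a b x y hx hy
    · intro y y' h h'
      rw [map_add, h, h', add_zero]
  · intro x x' h h'
    rw [map_add, LinearMap.add_apply, h, h', add_zero]

/-- In a nilpotent algebra, a one-dimensional derived algebra is central. -/
lemma bracket_eq_zero_of_commutator_eq_span (hA : A.IsNilpotent) {z : L}
    (hz : A.commutator ⊤ ⊤ = K ∙ z) (w : L) : A.bracket z w = 0 := by
  have hzw : A.bracket z w ∈ K ∙ z := hz ▸ bracket_mem_commutator z w
  obtain ⟨c, hc⟩ := Submodule.mem_span_singleton.1 hzw
  by_cases hc0 : c = 0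
  · rw [← hc, hc0, zero_smul]
  obtain ⟨k, hk⟩ := hA
  -- If [z,w] = cz with c ≠ 0, then z survives in every term of the lower central series.
  have hmem : ∀ i, z ∈ A.lowerSeries i := by
    intro i
    induction i with
    | zero => exact Submodule.mem_top
    | succ i ih =>
      have h : A.bracket z w ∈ A.lowerSeries (i + 1) :=
        Submodule.subset_span ⟨z, ih, w, trivial, rfl⟩
      rw [← hc] at h
      exact (Submodule.smul_mem_iff _ hc0).1 h
  have hz0 : z = 0 := by simpa [hk] using hmem k
  simp [hz0]

lemma bracket_eq_zero_of_commutator_eq_span' (hA : A.IsNilpotent) {a : ZMod 2} {z : L}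
    (ha : z ∈ A.part a) (hz : A.commutator ⊤ ⊤ = K ∙ z) (w : L) : A.bracket w z = 0 := by
  refine A.homogeneous_induction (P := fun w => A.bracket w z = 0) ?_ ?_ w
  · intro b w hw
    rw [A.skew hw ha, bracket_eq_zero_of_commutator_eq_span hA hz, smul_zero, neg_zero]
  · intro x y h h'
    rw [map_add, LinearMap.add_apply, h, h', add_zero]

lemma commutator_eq_span (hr : Module.finrank K (A.commutator ⊤ ⊤) = 1) {x y : L}
    (hxy : A.bracket x y ≠ 0) : A.commutator ⊤ ⊤ = K ∙ A.bracket x y := by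
  refine le_antisymm (fun w hw => ?_) ?_
  · obtain ⟨c, hc⟩ := (finrank_eq_one_iff_of_nonzero'
      (⟨_, bracket_mem_commutator x y⟩ : A.commutator ⊤ ⊤) (by simpa using hxy)).1 hr ⟨w, hw⟩
    exact Submodule.mem_span_singleton.2 ⟨c, congrArg Subtype.val hc⟩
  · rw [Submodule.span_singleton_le_iff_mem]
    exact bracket_mem_commutator x y

lemma exists_bracket_eq_smul (hr : Module.finrank K (A.commutator ⊤ ⊤) = 1) {x y : L}
    (hxy : A.bracket x y ≠ 0) (u v : L) : ∃ c : K, A.bracket u v = c • A.bracket x y := by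
  have h := bracket_mem_commutator (A := A) u v
  rw [commutator_eq_span hr hxy] at h
  obtain ⟨c, hc⟩ := Submodule.mem_span_singleton.1 h
  exact ⟨c, hc.symm⟩

/-- If the Jacobi identity holds in the exterior square, then a nonzero bracket which spans the
derived algebra has an even left factor. -/
lemma eq_zero_of_jacobiVanishes (h2 : (2 : K) ≠ 0) (h3 : (3 : K) ≠ 0) (hA : A.IsNilpotent)
    (hJ : A.JacobiVanishes) (hr : Module.finrank K (A.commutator ⊤ ⊤) = 1) {a b : ZMod 2} {x y : L}
    (hx : x ∈ A.part a) (hy : y ∈ A.part b) (hxy : A.bracket x y ≠ 0) : a = 0 := by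
  have key : ∀ a : ZMod 2, a = 0 ∨ a = 1 := by decide
  refine (key a).resolve_right ?_
  rintro rfl
  set z := A.bracket x y with hz
  have hzm : z ∈ A.part (1 + b) := A.bracket_mem hx hy
  have hspan := commutator_eq_span hr hxy
  have hzl : ∀ w, A.bracket z w = 0 := bracket_eq_zero_of_commutator_eq_span hA hspan
  have hzr := bracket_eq_zero_of_commutator_eq_span' hA hzm hspan
  obtain ⟨s, hs⟩ := exists_bracket_eq_smul hr hxy x x
  obtain ⟨t, ht⟩ := exists_bracket_eq_smul hr hxy y y
  -- With x odd, the two terms containing [x,y] and [y,x] add up instead of cancelling. The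
  -- expression becomes ±(2x + sy) ∧ z with [x,x] = sz, so 2x + sy is a multiple of z.
  have h := hJ 1 b 1 x y x hx hy hx
  have hu : A.jacobiTensor 1 b 1 x y x = ((-1 : K) ^ b.val • ((2 : K) • x + s • y)) ⊗ₜ z := by
    rw [jacobiTensor, A.skew hy hx, hs, ← hz]
    simp only [ZMod.val_one, mul_one, one_mul, pow_one, TensorProduct.tmul_neg,
      TensorProduct.tmul_smul, TensorProduct.add_tmul, ← TensorProduct.smul_tmul', smul_add,
      smul_smul, neg_mul, smul_neg]
    module
  rw [hu] at h
  obtain ⟨c, hc⟩ := Submodule.mem_span_singleton.1 (A.mem_span_of_superWedge_eq_zero hzm hxy h)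
  have hv : (2 : K) • x + s • y = ((-1 : K) ^ b.val * c) • z := by
    rw [mul_smul, hc, smul_smul, neg_one_pow_mul_self, one_smul]
  -- As z is central, bracketing with x on the left gives 3s = 0, and with y on the right gives 2 +
  -- st = 0. So s = 0, and then 2 = 0.
  have hleft := congrArg (A.bracket x) hv
  have hright := congrArg (fun v => A.bracket v y) hv
  simp only [map_add, map_smul, LinearMap.add_apply, LinearMap.smul_apply, hs, ht, hzl, hzr,
    ← hz, smul_zero, smul_smul, ← add_smul, smul_eq_zero, hxy, or_false] at hleft hright
  have hs0 : s = 0 := by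
    have : 3 * s = 0 := by rw [← hleft]; ring
    exact (mul_eq_zero.1 this).resolve_left h3
  rw [hs0] at hright
  exact h2 (by simpa using hright)

lemma isIsomorphic_heisenberg (h2 : (2 : K) ≠ 0) (h3 : (3 : K) ≠ 0) (hA : A.IsNilpotent)
    (hJ : A.JacobiVanishes) (hr : Module.finrank K (A.commutator ⊤ ⊤) = 1) :
    A.IsIsomorphic (heisenberg K) := by
  have hne : A.commutator ⊤ ⊤ ≠ ⊥ := by
    intro h
    rw [h, finrank_bot] at hr
    exact zero_ne_one hr
  obtain ⟨a, b, x, y, hx, hy, hxy⟩ := exists_homogeneous_bracket_ne_zero hne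
  obtain rfl := eq_zero_of_jacobiVanishes h2 h3 hA hJ hr hx hy hxy
  have hyx : A.bracket y x ≠ 0 := by
    intro h
    rw [A.skew hx hy, h] at hxy
    simp at hxy
  obtain rfl := eq_zero_of_jacobiVanishes h2 h3 hA hJ hr hy hx hyx
  set z := A.bracket x y with hz
  have hzm : z ∈ A.part 0 := A.bracket_mem hx hy
  have hspan := commutator_eq_span hr hxy
  have hzl : ∀ w, A.bracket z w = 0 := bracket_eq_zero_of_commutator_eq_span hA hspan
  have hzr := bracket_eq_zero_of_commutator_eq_span' hA hzm hspan
  have hself : ∀ w ∈ A.part 0, A.bracket w w = 0 := by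
    intro w hw
    have h := A.skew hw hw
    simp only [ZMod.val_zero, mul_zero, pow_zero, one_smul, eq_neg_iff_add_eq_zero] at h
    rw [← two_smul K] at h
    exact (smul_eq_zero.1 h).resolve_left h2
  have hyx' : A.bracket y x = -z := by
    rw [A.skew hy hx]
    simp [hz]
  set v : Fin 3 → L := ![x, y, z] with hv
  have hli : LinearIndependent K v := by
    rw [Fintype.linearIndependent_iff]
    intro g hg
    simp only [Fin.sum_univ_three, hv, Matrix.cons_val] at hg
    -- Bracketing the relation with x isolates the coefficient of y, and bracketing with y that of
    -- x.
    have hl := congrArg (A.bracket x) hg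
    have hm := congrArg (fun v => A.bracket v y) hg
    simp only [map_add, map_smul, LinearMap.add_apply, LinearMap.smul_apply, hzl, hzr, map_zero,
      LinearMap.zero_apply, hself x hx, hself y hy, ← hz, smul_zero, smul_eq_zero, hxy, or_false,
      add_zero, zero_add] at hl hm
    rw [hl, hm] at hg
    simp only [zero_smul, zero_add, smul_eq_zero, hxy, or_false] at hg
    intro i
    fin_cases i <;> assumption
  have hxs : x ∈ Submodule.span K (Set.range v) := Submodule.subset_span ⟨0, rfl⟩
  have hys : y ∈ Submodule.span K (Set.range v) := Submodule.subset_span ⟨1, rfl⟩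
  have hzs : z ∈ Submodule.span K (Set.range v) := Submodule.subset_span ⟨2, rfl⟩
  have hsp : ∀ w, w ∈ Submodule.span K (Set.range v) := by
    refine A.homogeneous_induction ?_ fun _ _ => add_mem
    intro c w hw
    obtain ⟨s, hs⟩ := exists_bracket_eq_smul hr hxy y w
    obtain ⟨t, ht⟩ := exists_bracket_eq_smul hr hxy w x
    -- Every term is a multiple of z on the right, so the vanishing wedge puts sx + ty + w in the
    -- line of z. The parity of w is arbitrary, which is what rules out odd elements.
    have hu : A.jacobiTensor 0 0 c x y w = (s • x + t • y + w) ⊗ₜ z := by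
      rw [jacobiTensor, hs, ht, ← hz]
      simp [TensorProduct.add_tmul, TensorProduct.smul_tmul']
    have h := hJ 0 0 c x y w hx hy hw
    rw [hu] at h
    obtain ⟨r, hr⟩ := Submodule.mem_span_singleton.1 (A.mem_span_of_superWedge_eq_zero hzm hxy h)
    have hw' : w = r • z - s • x - t • y := by
      rw [hr]; abel
    rw [hw']
    exact sub_mem (sub_mem (Submodule.smul_mem _ _ hzs) (Submodule.smul_mem _ _ hxs))
      (Submodule.smul_mem _ _ hys)
  have htop : A.part 0 = ⊤ := by
    refine top_le_iff.1 fun w _ => (Submodule.span_le.2 ?_ : _ ≤ A.part 0) (hsp w)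
    rintro _ ⟨i, rfl⟩
    fin_cases i <;> assumption
  have hbot : A.part 1 = ⊥ := by
    have := A.isCompl.disjoint
    rwa [htop, disjoint_comm, disjoint_top] at this
  let B := Module.Basis.mk hli fun w _ => hsp w
  have hB : ∀ w : L, w = B.equivFun w 0 • x + B.equivFun w 1 • y + B.equivFun w 2 • z := by
    intro w
    conv_lhs => rw [← B.sum_equivFun w]
    simp [Fin.sum_univ_three, B, hv]
  have hBz : B.equivFun z = ![0, 0, 1] := by
    have : z = B 2 := by simp [B, hv]
    rw [this]
    ext i
    rw [Module.Basis.equivFun_self]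
    fin_cases i <;> simp
  have hbr : ∀ u w, B.equivFun (A.bracket u w) =
      (heisenberg K).bracket (B.equivFun u) (B.equivFun w) := by
    intro u w
    have h : A.bracket u w =
        (B.equivFun u 0 * B.equivFun w 1 - B.equivFun u 1 * B.equivFun w 0) • z := by
      conv_lhs => rw [hB u, hB w]
      simp only [map_add, map_smul, LinearMap.add_apply, LinearMap.smul_apply, hzl, hzr,
        hself x hx, hself y hy, hyx', ← hz]
      module
    rw [h, map_smul, hBz]
    ext i
    fin_cases i <;> simp [heisenberg]
  have key : ∀ a : ZMod 2, a = 0 ∨ a = 1 := by decide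
  refine ⟨B.equivFun, ⟨fun a w hw => ?_, hbr⟩, ⟨fun a w hw => ?_, fun u w => ?_⟩⟩
  · rcases key a with rfl | rfl
    · exact Submodule.mem_top
    · rw [hbot, Submodule.mem_bot] at hw
      simp [hw]
  · rcases key a with rfl | rfl
    · rw [htop]
      exact Submodule.mem_top
    · have : w = 0 := by simpa [heisenberg] using hw
      simp [this]
  · apply B.equivFun.injective
    simp only [LinearEquiv.coe_coe]
    rw [hbr]
    simp only [LinearEquiv.apply_symm_apply]

lemma IsIsomorphic.part_one_eq_bot (h : A.IsIsomorphic (heisenberg K)) : A.part 1 = ⊥ := by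
  obtain ⟨e, he, -⟩ := h
  refine (Submodule.eq_bot_iff _).2 fun x hx => ?_
  have := he.map_part 1 x hx
  simpa [heisenberg] using this

lemma IsIsomorphic.finrank_commutator (h : A.IsIsomorphic (heisenberg K)) :
    Module.finrank K (A.commutator ⊤ ⊤) = 1 := by
  obtain ⟨e, he, he'⟩ := h
  have h01 : A.bracket (e.symm (Pi.single 0 1)) (e.symm (Pi.single 1 1)) =
      e.symm (Pi.single 2 1) := by
    apply e.injective
    have := he.map_bracket (e.symm (Pi.single 0 1)) (e.symm (Pi.single 1 1))
    simp only [LinearEquiv.coe_coe] at this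
    rw [this]
    ext i
    fin_cases i <;> simp [heisenberg]
  have : A.commutator ⊤ ⊤ = K ∙ e.symm (Pi.single 2 1) := by
    refine le_antisymm (Submodule.span_le.2 ?_) ?_
    · rintro _ ⟨x, -, y, -, rfl⟩
      refine Submodule.mem_span_singleton.2 ⟨e x 0 * e y 1 - e x 1 * e y 0, ?_⟩
      apply e.injective
      have := he.map_bracket x y
      simp only [LinearEquiv.coe_coe] at this
      rw [this, map_smul, LinearEquiv.apply_symm_apply]
      ext i
      fin_cases i <;> simp [heisenberg]
    · rw [Submodule.span_singleton_le_iff_mem, ← h01]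
      exact bracket_mem_commutator _ _
  rw [this, finrank_span_singleton]
  simp

lemma IsIsomorphic.jacobiVanishes (h : A.IsIsomorphic (heisenberg K)) : A.JacobiVanishes := by
  have hbot := h.part_one_eq_bot
  obtain ⟨e, he, he'⟩ := h
  have key : ∀ a : ZMod 2, a = 0 ∨ a = 1 := by decide
  have hodd : ∀ a : ZMod 2, ∀ x ∈ A.part a, a = 0 ∨ x = 0 := by
    intro a x hx
    refine (key a).imp_right ?_
    rintro rfl
    simpa [hbot] using hx
  have htop : A.part 0 = ⊤ := by
    have := A.isCompl.sup_eq_top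
    rwa [hbot, sup_bot_eq] at this
  intro a b c x y w hx hy hw
  rcases hodd a x hx with rfl | rfl
  on_goal 2 => simp [jacobiTensor]
  rcases hodd b y hy with rfl | rfl
  on_goal 2 => simp [jacobiTensor]
  rcases hodd c w hw with rfl | rfl
  on_goal 2 => simp [jacobiTensor]
  set z := e.symm (Pi.single 2 1) with hz
  have hbr : ∀ u v, A.bracket u v = (e u 0 * e v 1 - e u 1 * e v 0) • z := by
    intro u v
    apply e.injective
    have := he.map_bracket u v
    simp only [LinearEquiv.coe_coe] at this
    rw [this, map_smul, LinearEquiv.apply_symm_apply]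
    ext i
    fin_cases i <;> simp [heisenberg]
  -- The coefficients are the 2 × 2 minors of the first two coordinates of x, y, w. The first two
  -- coordinates of the sum are determinants with a repeated row, and c is the full 3 × 3
  -- determinant. The Jacobi expression is then c z ∧ z = 0 with z even.
  have hu : ∃ c : K, (e y 0 * e w 1 - e y 1 * e w 0) • x + (e w 0 * e x 1 - e w 1 * e x 0) • y +
      (e x 0 * e y 1 - e x 1 * e y 0) • w = c • z := by
    refine ⟨(e y 0 * e w 1 - e y 1 * e w 0) * e x 2 + (e w 0 * e x 1 - e w 1 * e x 0) * e y 2 +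
      (e x 0 * e y 1 - e x 1 * e y 0) * e w 2, ?_⟩
    apply e.injective
    ext i
    fin_cases i <;> simp [hz] <;> ring
  obtain ⟨c, hc⟩ := hu
  have hj : A.jacobiTensor 0 0 0 x y w = (c • z) ⊗ₜ z := by
    rw [← hc, jacobiTensor, hbr y w, hbr w x, hbr x y]
    simp [TensorProduct.add_tmul, TensorProduct.smul_tmul']
  have hzm : z ∈ A.part 0 := htop ▸ Submodule.mem_top
  rw [hj, superWedge_tmul A (Submodule.smul_mem _ c hzm) hzm]
  simp [TensorProduct.smul_tmul']

lemma jacobiVanishes_of_commutator_eq_bot (h : A.commutator ⊤ ⊤ = ⊥) : A.JacobiVanishes := by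
  have hb : ∀ x y, A.bracket x y = 0 := by
    intro x y
    have := bracket_mem_commutator (A := A) x y
    simpa [h] using this
  intro a b c x y z _ _ _
  simp [jacobiTensor, hb]

end RankOne

end LieSuperalgebra

end

theorem corollary3p6 {K : Type*} [Field K] [IsAlgClosed K] (h2 : (2 : K) ≠ 0) (h3 : (3 : K) ≠ 0)
    {L : Type*} [AddCommGroup L] [Module K L] [FiniteDimensional K L]
    (A : LieSuperalgebra K L) (hA : A.IsNilpotent)
    (m n : ℕ) (hm : Module.finrank K (A.part 0) = m) (hn : Module.finrank K (A.part 1) = n)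
    {X : Type*} (P : A.FreePresentation X) :
    Module.Finite K P.SchurMultiplier ∧
    ((Module.finrank K P.SchurMultiplier : ℚ) = 1 / 2 * (((m : ℚ) + n) ^ 2 + ((n : ℚ) - m)) - 1 ↔
      A.IsIsomorphic (LieSuperalgebra.heisenberg K)) ∧
    ((Module.finrank K P.SchurMultiplier : ℚ) = 1 / 2 * (((m : ℚ) + n) ^ 2 + ((n : ℚ) - m)) - 1 →
      A.part 1 = ⊥) := by
  have hiff : (Module.finrank K P.SchurMultiplier : ℚ) =
      1 / 2 * (((m : ℚ) + n) ^ 2 + ((n : ℚ) - m)) - 1 ↔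
        A.IsIsomorphic (LieSuperalgebra.heisenberg K) := by
    rw [← hm, ← hn, ← A.finrank_range_superWedge h2]
    have hadd := P.finrank_schurMultiplier_add
    have hle := P.finrank_range_coverBracket_le h2
    constructor
    · intro h
      have h' : Module.finrank K P.SchurMultiplier + 1 =
          Module.finrank K (LinearMap.range A.superWedge) := by
        have : (Module.finrank K P.SchurMultiplier : ℚ) + 1 =
          Module.finrank K (LinearMap.range A.superWedge) := by linarith
        exact_mod_cast this
      -- The bound gives dim [L,L] ≤ 1, and an abelian L would have a multiplier of dimension dim W,
      -- one too many.
      have hone : Module.finrank K (A.commutator ⊤ ⊤) = 1 := by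
        have hne : Module.finrank K (A.commutator ⊤ ⊤) ≠ 0 := by
          intro h0
          have := P.finrank_range_coverBracket_eq h2
            (LieSuperalgebra.jacobiVanishes_of_commutator_eq_bot (Submodule.finrank_eq_zero.1 h0))
          omega
        omega
      exact LieSuperalgebra.isIsomorphic_heisenberg h2 h3 hA
        -- With dim [L,L] = 1 the bound is attained.
        (P.jacobiVanishes_of_finrank_eq h2 (by omega)) hone
    · intro h
      rw [P.finrank_range_coverBracket_eq h2 h.jacobiVanishes, h.finrank_commutator] at hadd
      rw [← hadd]
      simp
  exact ⟨P.finite_schurMultiplier, hiff, fun h => (hiff.1 h).part_one_eq_bot⟩
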